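/- Let $\mathrm{He}_l(x)=(-1)^l e^{x^2/2}\frac{\mathrm{d}^l}{\mathrm{d}x^l}e^{-x^2/2}$ denote the $l$-th (probabilists') Hermite polynomial. For any natural numbers $K$ and $L$, there exists a real polynomial $f:\mathbb{R}\to\mathbb{R}$ that is not constant (in particular, not identically zero) and satisfies $$\int_{\mathbb{R}} f(x)^k\,\mathrm{He}_l(x)\,e^{-x^2/2}\,\mathrm{d}x=0$$ for all integers $1\le k\le K$ and $1\le l\le L$. -/

import Mathlib

open Filter Topology MeasureTheory Polynomial

/-! It suffices that each moment E[f^k x^l] under the Gaussian weight factors as c_k E[x^l]: then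
f^k is orthogonal to every He_l with l ≥ 1, because He_l is orthogonal to 1. As N → ∞, cos(Nx)
becomes independent of x in this sense (`tendsto_integral_mul_cos_pow`), and its Taylor polynomials
p approximate its moments. So the functionals g ↦ E[g(x, p(x))] have in their closure the law of an
independent pair (x, cos u). A finite-dimensional implicit function argument
(`exists_perturbation_moments_eq`) makes finitely many approximate identities exact, replacing Y = p
by Y + ∑ t_ij Y^i x^j. Its linearization is, up to nonzero row factors, a Kronecker product of two
Hankel matrices, nonsingular because both laws are definite. -/

/-! ### Perturbing approximate moment identities into exact ones -/

/-- If the derivative of `F` in the second variable is injective, the level set of `F` through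
`(a, b)` meets every nearby vertical slice. -/
theorem eventually_exists_eq_of_partial_deriv_injective {E T : Type*}
    [NormedAddCommGroup E] [NormedSpace ℝ E] [FiniteDimensional ℝ E]
    [NormedAddCommGroup T] [NormedSpace ℝ T] [FiniteDimensional ℝ T]
    {F : E × T → T} {F' : E × T →L[ℝ] T} {a : E} {b : T}
    (hF : HasStrictFDerivAt F F' (a, b)) (hinj : ∀ h : T, F' (0, h) = 0 → h = 0) :
    ∀ᶠ x in 𝓝 a, ∃ t, F (x, t) = F (a, b) := by
  have := FiniteDimensional.complete ℝ E
  have := FiniteDimensional.complete ℝ T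
  -- Adjoining the first coordinate gives a self-map of E × T, where an injective derivative is
  -- surjective and the map is therefore open at the point.
  have hG : HasStrictFDerivAt (fun z : E × T => (z.1, F z))
      ((ContinuousLinearMap.fst ℝ E T).prod F') (a, b) :=
    hasStrictFDerivAt_fst.prodMk hF
  have hker : Function.Injective ((ContinuousLinearMap.fst ℝ E T).prod F') := by
    rw [injective_iff_map_eq_zero]
    rintro ⟨x, t⟩ hz
    obtain ⟨hx, ht⟩ := Prod.mk_eq_zero.1 hz
    have hx : x = 0 := hx
    subst hx
    rw [hinj t ht]
    rfl
  have hsurj : ((ContinuousLinearMap.fst ℝ E T).prod F').range = ⊤ :=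
    LinearMap.range_eq_top.2
      (LinearMap.injective_iff_surjective (f := (((ContinuousLinearMap.fst ℝ E T).prod F' :
        E × T →L[ℝ] E × T) : E × T →ₗ[ℝ] E × T)).1 hker)
  have hmap := hG.map_nhds_eq_of_surj hsurj
  have hrange : Set.range (fun z : E × T => (z.1, F z)) ∈ 𝓝 (a, F (a, b)) := by
    rw [← hmap]
    exact mem_map.2 (univ_mem' fun z => ⟨z, rfl⟩)
  have hcont : Tendsto (fun x : E => (x, F (a, b))) (𝓝 a) (𝓝 (a, F (a, b))) :=
    (continuous_id.prodMk continuous_const).tendsto a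
  filter_upwards [hcont hrange] with x hx
  obtain ⟨z, hz⟩ := hx
  obtain ⟨h1, h2⟩ := Prod.mk.inj hz
  exact ⟨z.2, by rw [← h1]; exact h2⟩

/-- The value of a linear functional on `(Y + ∑ j, t j • Q j) ^ n * W` in terms of its values on
products of the elements `Y` and `Q j`. -/
theorem LinearMap.map_add_sum_smul_pow_mul {R ι : Type*} [CommRing R] [Algebra ℝ R] [Fintype ι]
    (Φ : R →ₗ[ℝ] ℝ) (Y W : R) (Q : ι → R) (n : ℕ) (t : ι → ℝ) :
    Φ ((Y + ∑ j, t j • Q j) ^ n * W) =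
      ∑ s : Fin n → Option ι,
        Φ ((∏ j, (s j).elim Y Q) * W) * ∏ j, (s j).elim 1 t := by
  have h : Y + ∑ j, t j • Q j = ∑ o : Option ι, (o.elim 1 t : ℝ) • (o.elim Y Q : R) := by
    simp [Fintype.sum_option]
  rw [h, Fintype.sum_pow, Finset.sum_mul, map_sum]
  refine Finset.sum_congr rfl fun s _ => ?_
  rw [Finset.prod_smul, smul_mul_assoc, map_smul, smul_eq_mul, mul_comm]

/-- By the binomial theorem the function is a polynomial in ε, and its derivative at 0 is the
coefficient of ε. -/
theorem hasDerivAt_map_add_smul_pow_mul {R : Type*} [CommRing R] [Algebra ℝ R]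
    (Φ : R →ₗ[ℝ] ℝ) (Y H W : R) (n : ℕ) :
    HasDerivAt (fun ε : ℝ => Φ ((Y + ε • H) ^ (n + 1) * W))
      ((n + 1) * Φ (Y ^ n * H * W)) 0 := by
  have h : ∀ ε : ℝ, Φ ((Y + ε • H) ^ (n + 1) * W) =
      (∑ r ∈ Finset.range (n + 1 + 1), Polynomial.monomial r
        (Φ (Y ^ (n + 1 - r) * H ^ r * ((n + 1).choose r : R) * W))).eval ε := by
    intro ε
    rw [add_comm Y, add_pow, Finset.sum_mul, map_sum, Polynomial.eval_finsetSum]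
    refine Finset.sum_congr rfl fun r _ => ?_
    rw [Polynomial.eval_monomial, _root_.smul_pow, smul_mul_assoc, smul_mul_assoc, smul_mul_assoc,
      map_smul, smul_eq_mul, mul_comm, mul_comm (H ^ r)]
  simp_rw [h]
  refine (Polynomial.hasDerivAt _ (0 : ℝ)).congr_deriv ?_
  rw [← Polynomial.coeff_zero_eq_eval_zero, Polynomial.coeff_derivative,
    Polynomial.finsetSum_coeff]
  simp only [Polynomial.coeff_monomial]
  simp only [zero_add, Finset.sum_ite_eq', Finset.mem_range]
  have : Y ^ n * H * ((n + 1 : ℕ) : R) * W = ((n : ℝ) + 1) • (Y ^ n * H * W) := by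
    rw [Algebra.smul_def]; push_cast; ring
  simp only [Nat.choose_one_right, pow_one, Nat.add_sub_cancel, this, map_smul]
  simp

/-- If `Φ₀` is a pointwise limit of functionals in `S`, and satisfies a nondegeneracy condition,
then a perturbation of `Y` has with respect to some member of `S` the same moments that `Y` has
with respect to `Φ₀`. -/
theorem exists_perturbation_moments_eq {R ι : Type*} [CommRing R] [Algebra ℝ R] [Fintype ι]
    (Y : R) (Q W : ι → R) (n : ι → ℕ) (S : Set (R → ℝ)) (hS : ∀ φ ∈ S, IsLinearMap ℝ φ)
    (Φ₀ : R →ₗ[ℝ] ℝ) (hcl : (Φ₀ : R → ℝ) ∈ closure S)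
    (hinj : ∀ h : ι → ℝ, (∀ e, Φ₀ (Y ^ n e * (∑ j, h j • Q j) * W e) = 0) → h = 0) :
    ∃ φ ∈ S, ∃ t : ι → ℝ, ∀ e,
      φ ((Y + ∑ j, t j • Q j) ^ (n e + 1) * W e) = Φ₀ (Y ^ (n e + 1) * W e) := by
  classical
  -- Only the finitely many moments indexed by `J` enter, so pointwise closeness of functionals is
  -- enough.
  let J := Σ e : ι, (Fin (n e + 1) → Option ι)
  let F : (J → ℝ) × (ι → ℝ) → (ι → ℝ) := fun z e =>
    ∑ s : Fin (n e + 1) → Option ι, z.1 ⟨e, s⟩ * ∏ j, (s j).elim 1 z.2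
  let m : (R → ℝ) → (J → ℝ) := fun φ q => φ ((∏ j, (q.2 j).elim Y Q) * W q.1)
  have hFm : ∀ (Φ : R →ₗ[ℝ] ℝ) t e,
      F (m Φ, t) e = Φ ((Y + ∑ j, t j • Q j) ^ (n e + 1) * W e) := fun Φ t e =>
    (Φ.map_add_sum_smul_pow_mul Y (W e) Q (n e + 1) t).symm
  have hm : Continuous m := continuous_pi fun q => continuous_apply _
  have hF : ContDiff ℝ 1 F := by
    refine contDiff_pi.2 fun e => ContDiff.sum fun s _ => ContDiff.mul ?_ (contDiff_prod ?_)
    · exact (contDiff_apply ℝ ℝ (⟨e, s⟩ : J)).comp contDiff_fst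
    · intro j _
      rcases s j with _ | o
      · exact contDiff_const
      · exact (contDiff_apply ℝ ℝ o).comp contDiff_snd
  have hF' := (hF.contDiffAt (x := (m Φ₀, (0 : ι → ℝ)))).hasStrictFDerivAt one_ne_zero
  have key := eventually_exists_eq_of_partial_deriv_injective hF' (by
    intro h hh
    refine hinj h fun e => ?_
    have h1 : HasDerivAt (fun ε : ℝ => ((m Φ₀, ε • h) : (J → ℝ) × (ι → ℝ))) (0, h) 0 := by
      refine (hasDerivAt_const _ _).prodMk ?_
      simpa using (hasDerivAt_id (0 : ℝ)).smul_const h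
    have h2 := HasFDerivAt.comp_hasDerivAt (0 : ℝ) (f := fun ε : ℝ => (m Φ₀, ε • h))
      (l := F) (l' := fderiv ℝ F (m Φ₀, 0)) (by rw [zero_smul]; exact hF'.hasFDerivAt) h1
    rw [hh] at h2
    have h3 := hasDerivAt_pi.1 h2 e
    have h4 := hasDerivAt_map_add_smul_pow_mul Φ₀ Y (∑ j, h j • Q j) (W e) (n e)
    have h5 : (fun ε : ℝ => Φ₀ ((Y + ε • ∑ j, h j • Q j) ^ (n e + 1) * W e)) =
        fun ε : ℝ => (F ∘ fun ε : ℝ => (m Φ₀, ε • h)) ε e := by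
      funext ε
      simp only [Function.comp, hFm, Finset.smul_sum, Pi.smul_apply, smul_smul, smul_eq_mul]
    rw [h5] at h4
    have h6 := h4.unique h3
    have h7 : ((n e : ℝ) + 1) ≠ 0 := by positivity
    simpa [h7] using h6)
  obtain ⟨φ, ⟨t, ht⟩, hφ⟩ := mem_closure_iff_nhds.1 hcl _ (hm.continuousAt key)
  refine ⟨φ, hφ, t, fun e => ?_⟩
  have h1 := congrFun ht e
  have h2 := hFm ((hS φ hφ).mk' φ) t e
  rw [hFm Φ₀] at h1
  simp only [Pi.zero_apply, zero_smul, Finset.sum_const_zero, add_zero] at h1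
  rw [← h1]
  exact h2.symm

/-! ### The Gaussian functional -/

theorem integrable_exp_mul_abs_mul_exp_neg_sq (c : ℝ) :
    Integrable fun x : ℝ => Real.exp (c * |x|) * Real.exp (-(x ^ 2 / 2)) := by
  refine ((integrable_exp_neg_mul_sq (b := 1 / 4) (by norm_num)).const_mul
    (Real.exp (c ^ 2))).mono' (by fun_prop) (ae_of_all _ fun x => ?_)
  rw [Real.norm_of_nonneg (by positivity), ← Real.exp_add, ← Real.exp_add]
  refine Real.exp_le_exp.2 ?_
  nlinarith [sq_nonneg (c - |x| / 2), sq_abs x]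

theorem Polynomial.exists_abs_eval_le_exp_abs (p : ℝ[X]) :
    ∃ A : ℝ, ∀ x : ℝ, |p.eval x| ≤ A * Real.exp |x| := by
  induction p using Polynomial.induction_on' with
  | add p q hp hq =>
    obtain ⟨A, hA⟩ := hp
    obtain ⟨B, hB⟩ := hq
    refine ⟨A + B, fun x => ?_⟩
    rw [eval_add, add_mul]
    exact (abs_add_le _ _).trans (add_le_add (hA x) (hB x))
  | monomial n a =>
    refine ⟨|a| * n.factorial, fun x => ?_⟩
    have h := Real.pow_div_factorial_le_exp |x| (abs_nonneg x) n
    rw [div_le_iff₀ (by positivity)] at h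
    rw [eval_monomial, abs_mul, abs_pow, mul_assoc, mul_comm (n.factorial : ℝ)]
    gcongr

/-- The majorant does not depend on y, so it serves all Taylor polynomials of cos(Nx) at once. -/
theorem Polynomial.exists_bound_mul_exp_neg_sq (p : ℝ[X]) (c : ℝ) :
    ∃ g : ℝ → ℝ, Integrable g ∧ ∀ x y : ℝ, |y| ≤ Real.exp (c * |x|) →
      ‖p.eval x * y * Real.exp (-(x ^ 2 / 2))‖ ≤ g x := by
  obtain ⟨A, hA⟩ := p.exists_abs_eval_le_exp_abs
  refine ⟨fun x => A * (Real.exp ((1 + c) * |x|) * Real.exp (-(x ^ 2 / 2))),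
    (integrable_exp_mul_abs_mul_exp_neg_sq _).const_mul A, fun x y hy => ?_⟩
  rw [norm_mul, norm_mul, Real.norm_eq_abs, Real.norm_eq_abs,
    Real.norm_of_nonneg (Real.exp_pos _).le]
  beta_reduce
  rw [← mul_assoc A, add_mul, one_mul, Real.exp_add, ← mul_assoc A]
  have h := mul_le_mul (hA x) hy (abs_nonneg y) ((abs_nonneg _).trans (hA x))
  exact mul_le_mul_of_nonneg_right h (Real.exp_pos _).le

theorem Polynomial.integrable_eval_mul_exp_neg_sq (p : ℝ[X]) :
    Integrable fun x : ℝ => p.eval x * Real.exp (-(x ^ 2 / 2)) := by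
  obtain ⟨g, hg, hb⟩ := p.exists_bound_mul_exp_neg_sq 0
  refine hg.mono' (by fun_prop) (ae_of_all _ fun x => ?_)
  simpa using hb x 1 (by simp)

/-- Integration of polynomials against `exp (-(x ^ 2 / 2))`. -/
noncomputable def gaussianFunctional : ℝ[X] →ₗ[ℝ] ℝ where
  toFun p := ∫ x : ℝ, p.eval x * Real.exp (-(x ^ 2 / 2))
  map_add' p q := by
    simp_rw [eval_add, add_mul]
    exact integral_add p.integrable_eval_mul_exp_neg_sq q.integrable_eval_mul_exp_neg_sq
  map_smul' a p := by
    simp_rw [eval_smul, smul_eq_mul, mul_assoc]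
    exact integral_const_mul _ _

theorem gaussianFunctional_apply (p : ℝ[X]) :
    gaussianFunctional p = ∫ x : ℝ, p.eval x * Real.exp (-(x ^ 2 / 2)) := rfl

theorem eq_zero_of_gaussianFunctional_sq_eq_zero {p : ℝ[X]}
    (h : gaussianFunctional (p ^ 2) = 0) : p = 0 := by
  have h1 : (fun x : ℝ => (p ^ 2).eval x * Real.exp (-(x ^ 2 / 2))) =ᵐ[volume] 0 := by
    refine (integral_eq_zero_iff_of_nonneg (fun x => ?_)
      (p ^ 2).integrable_eval_mul_exp_neg_sq).1 h
    simp only [eval_pow, Pi.zero_apply]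
    positivity
  have h2 := (Continuous.ae_eq_iff_eq volume (by fun_prop) (by fun_prop)).1 h1
  refine Polynomial.funext fun x => ?_
  have h3 := congrFun h2 x
  simpa [Real.exp_ne_zero] using h3

/-! ### The cosine functional and Hankel matrices -/

/-- The average of `p (cos u)` over a period. -/
noncomputable def cosFunctional : ℝ[X] →ₗ[ℝ] ℝ where
  toFun p := (2 * Real.pi)⁻¹ * ∫ u in (0 : ℝ)..2 * Real.pi, p.eval (Real.cos u)
  map_add' p q := by
    simp_rw [eval_add]
    rw [intervalIntegral.integral_add, mul_add] <;>
      exact Continuous.intervalIntegrable (by fun_prop) _ _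
  map_smul' a p := by
    simp_rw [eval_smul, smul_eq_mul, intervalIntegral.integral_const_mul]
    simp only [RingHom.id_apply]
    ring

theorem cosFunctional_apply (p : ℝ[X]) : cosFunctional p =
    (2 * Real.pi)⁻¹ * ∫ u in (0 : ℝ)..2 * Real.pi, p.eval (Real.cos u) := rfl

theorem eq_zero_of_cosFunctional_sq_eq_zero {p : ℝ[X]}
    (h : cosFunctional (p ^ 2) = 0) : p = 0 := by
  have hpi := Real.pi_pos
  have h0 : ∫ u in (0 : ℝ)..2 * Real.pi, (p ^ 2).eval (Real.cos u) = 0 := by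
    rw [cosFunctional_apply] at h
    exact (mul_eq_zero.1 h).resolve_left (by positivity)
  by_contra hp
  have hfin : {u | u ∈ p.roots.toFinset}.Finite := p.roots.toFinset.finite_toSet
  have hinf : (Set.Icc (-1 : ℝ) 1).Infinite := Set.Icc_infinite (by norm_num)
  obtain ⟨y, hy, hyr⟩ := hinf.exists_notMem_finite hfin
  have hne : p.eval y ≠ 0 := fun h => hyr (by simp [hp, h])
  have hpos : 0 < ∫ u in (0 : ℝ)..2 * Real.pi, (p ^ 2).eval (Real.cos u) := by
    refine intervalIntegral.integral_pos (by positivity)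
      (Continuous.continuousOn (by fun_prop)) (fun u _ => by simp only [eval_pow]; positivity)
      ⟨Real.arccos y, ⟨Real.arccos_nonneg y, by linarith [Real.arccos_le_pi y]⟩, ?_⟩
    rw [Real.cos_arccos hy.1 hy.2, eval_pow]
    positivity
  exact hpos.ne' h0

/-- The Hankel matrices of a definite functional are nonsingular. -/
theorem LinearMap.eq_zero_of_sum_mul_map_X_pow_eq_zero (Φ : ℝ[X] →ₗ[ℝ] ℝ)
    (hΦ : ∀ p, Φ (p ^ 2) = 0 → p = 0) {n : ℕ} (v : Fin n → ℝ)
    (hv : ∀ i : Fin n, ∑ j : Fin n, v j * Φ (X ^ (i + j : ℕ)) = 0) : v = 0 := by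
  set p : ℝ[X] := ∑ j : Fin n, v j • X ^ (j : ℕ) with hp
  have h0 : p = 0 := hΦ p <| by
    rw [sq]
    nth_rewrite 1 [hp]
    rw [Finset.sum_mul, map_sum]
    refine Finset.sum_eq_zero fun i _ => ?_
    rw [smul_mul_assoc, map_smul, hp, Finset.mul_sum, map_sum]
    simp_rw [mul_smul_comm, map_smul, ← pow_add, smul_eq_mul]
    rw [hv i, mul_zero]
  funext i
  have h1 := congrArg (fun q => coeff q (i : ℕ)) h0
  simpa [hp, finsetSum_coeff, coeff_X_pow, Fin.val_inj] using h1

/-! ### Asymptotic independence of cos(Nx) and x -/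

theorem Real.tendsto_integral_cos_mul_atTop (f : ℝ → ℝ) (hf : Integrable f) :
    Tendsto (fun w : ℝ => ∫ x, Real.cos (w * x) * f x) (cocompact ℝ) (𝓝 0) := by
  have hpi := Real.pi_pos
  have h := Real.tendsto_integral_exp_smul_cocompact (fun x => (f x : ℂ))
  have hscale : Tendsto (fun w : ℝ => w * (2 * Real.pi)⁻¹) (cocompact ℝ) (cocompact ℝ) :=
    tendsto_cocompact_mul_right₀ (by positivity)
  have h2 := (Complex.continuous_re.tendsto _).comp (h.comp hscale)
  refine h2.congr fun w => ?_
  simp only [Function.comp]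
  rw [← RCLike.re_eq_complex_re, ← integral_re]
  · refine integral_congr_ae (ae_of_all _ fun x => ?_)
    have : 2 * Real.pi * (-(x * (w * (2 * Real.pi)⁻¹))) = -(w * x) := by field_simp
    simp only [Circle.smul_def, Real.fourierChar_apply, smul_eq_mul, RCLike.re_eq_complex_re,
      Complex.re_mul_ofReal, Complex.exp_ofReal_mul_I_re, this, Real.cos_neg]
  · have h3 := (Real.fourierIntegral_convergent_iff (μ := volume) (f := fun x => (f x : ℂ))
      (w * (2 * Real.pi)⁻¹)).2 hf.ofReal
    simpa [mul_comm] using h3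

/-- The extra factor cos(ju) lets the induction close: the product-to-sum formula trades a power of
cos u for a shift of j by ±1, and the case a = 0 is the Riemann–Lebesgue lemma. -/
theorem tendsto_integral_cos_pow_mul_cos_mul {f : ℝ → ℝ} (hf : Integrable f) (a : ℕ) (j : ℤ) :
    Tendsto (fun N : ℕ => ∫ x, Real.cos (N * x) ^ a * Real.cos (j * (N * x)) * f x) atTop
      (𝓝 (((2 * Real.pi)⁻¹ * ∫ u in (0 : ℝ)..2 * Real.pi, Real.cos u ^ a * Real.cos (j * u)) *
        ∫ x, f x)) := by
  have hpi := Real.pi_pos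
  induction a generalizing j with
  | zero =>
    simp only [pow_zero, one_mul]
    rcases eq_or_ne j 0 with rfl | hj
    · have : (2 * Real.pi)⁻¹ * (2 * Real.pi) = 1 := inv_mul_cancel₀ (by positivity)
      simp only [Int.cast_zero, zero_mul, Real.cos_zero, one_mul, intervalIntegral.integral_const,
        sub_zero, smul_eq_mul, mul_one, this, tendsto_const_nhds]
    · have hj' : (j : ℝ) ≠ 0 := by exact_mod_cast hj
      have h0 : ∫ u in (0 : ℝ)..2 * Real.pi, Real.cos (j * u) = 0 := by
        rw [intervalIntegral.integral_comp_mul_left _ hj', integral_cos]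
        have : Real.sin (j * (2 * Real.pi)) = 0 := by
          have := Real.sin_int_mul_pi (j * 2)
          push_cast at this
          rwa [mul_assoc] at this
        simp [this]
      rw [h0, mul_zero, zero_mul]
      have hN : Tendsto (fun N : ℕ => (j : ℝ) * N) atTop (cocompact ℝ) :=
        (tendsto_cocompact_mul_left₀ hj').comp
          (tendsto_natCast_atTop_atTop.mono_right atTop_le_cocompact)
      refine ((Real.tendsto_integral_cos_mul_atTop f hf).comp hN).congr fun N => ?_
      simp only [Function.comp, mul_assoc]
  | succ a ih =>
    have hstep : ∀ u : ℝ, Real.cos u ^ (a + 1) * Real.cos (j * u) =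
        2⁻¹ * (Real.cos u ^ a * Real.cos ((j + 1 : ℤ) * u) +
          Real.cos u ^ a * Real.cos ((j - 1 : ℤ) * u)) := fun u => by
      push_cast
      rw [add_mul, sub_mul, one_mul, Real.cos_add, Real.cos_sub]
      ring
    have hint : ∀ (N : ℕ) (i : ℤ), Integrable fun x =>
        Real.cos (N * x) ^ a * Real.cos (i * (N * x)) * f x := fun N i => by
      refine hf.bdd_mul (c := 1) (Continuous.aestronglyMeasurable (by fun_prop))
        (ae_of_all _ fun x => ?_)
      rw [norm_mul, norm_pow]
      exact mul_le_one₀ (pow_le_one₀ (norm_nonneg _) (Real.abs_cos_le_one _)) (norm_nonneg _)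
        (Real.abs_cos_le_one _)
    have h := ((ih (j + 1)).add (ih (j - 1))).const_mul (2⁻¹ : ℝ)
    simp_rw [hstep]
    rw [intervalIntegral.integral_const_mul, intervalIntegral.integral_add
      (Continuous.intervalIntegrable (by fun_prop) _ _)
      (Continuous.intervalIntegrable (by fun_prop) _ _)]
    convert h using 2 with N
    · simp_rw [mul_assoc (2⁻¹ : ℝ), add_mul]
      rw [integral_const_mul, integral_add (hint N _) (hint N _)]
    · ring

theorem tendsto_integral_mul_cos_pow {f : ℝ → ℝ} (hf : Integrable f) (a : ℕ) :
    Tendsto (fun N : ℕ => ∫ x, Real.cos (N * x) ^ a * f x) atTop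
      (𝓝 (cosFunctional (X ^ a) * ∫ x, f x)) := by
  simpa [cosFunctional_apply] using tendsto_integral_cos_pow_mul_cos_mul hf a 0

/-! ### Polynomial approximation of cos(Nx) -/

/-- The Taylor polynomials of `cos (N * x)`. -/
noncomputable def cosTaylor (N M : ℕ) : ℝ[X] :=
  ∑ r ∈ Finset.range M, C ((-1) ^ r * (N : ℝ) ^ (2 * r) / (2 * r).factorial) * X ^ (2 * r)

theorem cosTaylor_eval (N M : ℕ) (x : ℝ) : (cosTaylor N M).eval x =
    ∑ r ∈ Finset.range M, (-1) ^ r * (N * x) ^ (2 * r) / (2 * r).factorial := by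
  rw [cosTaylor, eval_finsetSum]
  refine Finset.sum_congr rfl fun r _ => ?_
  rw [eval_mul, eval_C, eval_pow, eval_X, mul_pow]
  ring

theorem tendsto_cosTaylor_eval (N : ℕ) (x : ℝ) :
    Tendsto (fun M => (cosTaylor N M).eval x) atTop (𝓝 (Real.cos (N * x))) := by
  simp_rw [cosTaylor_eval]
  exact (Real.hasSum_cos (N * x)).tendsto_sum_nat

/-- The absolute values of the terms are those of the cosh series. -/
theorem abs_cosTaylor_eval_le (N M : ℕ) (x : ℝ) :
    |(cosTaylor N M).eval x| ≤ Real.exp (N * |x|) := by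
  have hNx : (N : ℝ) * |x| = |N * x| := by rw [abs_mul, Nat.abs_cast]
  rw [cosTaylor_eval, hNx]
  refine (Finset.abs_sum_le_sum_abs _ _).trans ?_
  have h1 := (Real.hasSum_cosh |N * x|).summable.sum_le_tsum (Finset.range M)
    (fun i _ => by positivity)
  rw [← Real.cosh_eq_tsum] at h1
  refine le_trans (le_of_eq (Finset.sum_congr rfl fun r _ => ?_)) (h1.trans ?_)
  · simp [abs_div, abs_mul, abs_pow]
  · rw [Real.cosh_eq]
    have : Real.exp (-|N * x|) ≤ Real.exp |N * x| :=
      Real.exp_le_exp.2 (by linarith [abs_nonneg (N * x)])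
    linarith

theorem tendsto_gaussianFunctional_mul_cosTaylor_pow (q : ℝ[X]) (N a : ℕ) :
    Tendsto (fun M => gaussianFunctional (q * cosTaylor N M ^ a)) atTop
      (𝓝 (∫ x : ℝ, Real.cos (N * x) ^ a * (q.eval x * Real.exp (-(x ^ 2 / 2))))) := by
  obtain ⟨g, hg, hb⟩ := q.exists_bound_mul_exp_neg_sq (a * N)
  simp_rw [gaussianFunctional_apply]
  refine tendsto_integral_of_dominated_convergence g
    (fun M => Continuous.aestronglyMeasurable (by fun_prop)) hg
    (fun M => ae_of_all _ fun x => ?_) (ae_of_all _ fun x => ?_)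
  · rw [eval_mul]
    refine hb x _ ?_
    rw [eval_pow, abs_pow, mul_assoc, Real.exp_nat_mul]
    exact pow_le_pow_left₀ (abs_nonneg _) (abs_cosTaylor_eval_le N M x) a
  · have h := (((tendsto_cosTaylor_eval N x).pow a).const_mul (q.eval x)).mul_const
      (Real.exp (-(x ^ 2 / 2)))
    simp only [eval_mul, eval_pow]
    convert h using 2
    ring

/-! ### The limit functional and the construction of f -/

/-- The functional on polynomials in two variables for which the variables are independent, the
outer one distributed as `cos u` and the inner one Gaussian. -/
noncomputable def cosGaussianFunctional : ℝ[X][X] →ₗ[ℝ] ℝ :=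
  lsum fun a => cosFunctional (X ^ a) • gaussianFunctional

theorem cosGaussianFunctional_apply (g : ℝ[X][X]) : cosGaussianFunctional g =
    ∑ a ∈ g.support, cosFunctional (X ^ a) * gaussianFunctional (g.coeff a) := rfl

theorem cosGaussianFunctional_X_pow_mul_C (a : ℕ) (q : ℝ[X]) :
    cosGaussianFunctional (X ^ a * C q) = cosFunctional (X ^ a) * gaussianFunctional q := by
  rw [X_pow_mul, C_mul_X_pow_eq_monomial]
  exact sum_monomial_index q (fun a q => cosFunctional (X ^ a) * gaussianFunctional q)
    (by rw [map_zero, mul_zero])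

theorem gaussianFunctional_eval (g : ℝ[X][X]) (p : ℝ[X]) : gaussianFunctional (g.eval p) =
    ∑ a ∈ g.support, gaussianFunctional (g.coeff a * p ^ a) := by
  rw [eval_eq_sum, sum_def, map_sum]

theorem cosGaussianFunctional_mem_closure :
    (cosGaussianFunctional : ℝ[X][X] → ℝ) ∈
      closure (Set.range fun (p : ℝ[X]) (g : ℝ[X][X]) => gaussianFunctional (g.eval p)) := by
  -- The limit is iterated, first M → ∞ and then N → ∞, so the closure is taken twice.
  rw [← closure_closure]
  refine mem_closure_of_tendsto (b := atTop) (f := fun (N : ℕ) (g : ℝ[X][X]) =>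
    ∑ a ∈ g.support, ∫ x : ℝ, Real.cos (N * x) ^ a *
      ((g.coeff a).eval x * Real.exp (-(x ^ 2 / 2)))) ?_ (Eventually.of_forall fun N => ?_)
  · refine tendsto_pi_nhds.2 fun g => ?_
    rw [cosGaussianFunctional_apply]
    exact tendsto_finsetSum _ fun a _ =>
      tendsto_integral_mul_cos_pow (g.coeff a).integrable_eval_mul_exp_neg_sq a
  · refine mem_closure_of_tendsto (b := atTop) (f := fun (M : ℕ) (g : ℝ[X][X]) =>
      gaussianFunctional (g.eval (cosTaylor N M))) ?_
      (Eventually.of_forall fun M => Set.mem_range_self _)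
    refine tendsto_pi_nhds.2 fun g => ?_
    simp_rw [gaussianFunctional_eval]
    exact tendsto_finsetSum _ fun a _ => tendsto_gaussianFunctional_mul_cosTaylor_pow _ N a

/-- There are polynomials whose powers are to any finite order uncorrelated with the monomials
under the Gaussian measure, with the moments of `cos u`. -/
theorem exists_gaussianFunctional_pow_mul_X_pow_eq (K L : ℕ) :
    ∃ f : ℝ[X], ∀ k < K, ∀ l < L, gaussianFunctional (f ^ (k + 1) * X ^ l) =
      cosFunctional (X ^ (k + 1)) * gaussianFunctional (X ^ l) := by
  obtain ⟨φ, ⟨p, rfl⟩, t, ht⟩ := exists_perturbation_moments_eq (ι := Fin K × Fin L)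
    (X : ℝ[X][X]) (fun j => X ^ (j.1 : ℕ) * C (X ^ (j.2 : ℕ))) (fun j => C (X ^ (j.2 : ℕ)))
    (fun j => j.1) _ (by
      rintro _ ⟨p, rfl⟩
      exact ⟨fun g h => by simp, fun a g => by
        beta_reduce
        rw [eval_smul, map_smul]⟩) cosGaussianFunctional cosGaussianFunctional_mem_closure
    (by
      intro h hh
      have h1 : ∀ (i : Fin K) (l : Fin L), ∑ l' : Fin L, (∑ i' : Fin K, h (i', l') *
          cosFunctional (X ^ (i + i' : ℕ))) * gaussianFunctional (X ^ (l + l' : ℕ)) = 0 := by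
        intro i l
        rw [← hh (i, l), Finset.mul_sum, Finset.sum_mul, map_sum, Fintype.sum_prod_type_right]
        refine Finset.sum_congr rfl fun l' _ => ?_
        rw [Finset.sum_mul]
        refine Finset.sum_congr rfl fun i' _ => ?_
        have : (X ^ (i : ℕ) * h (i', l') • (X ^ (i' : ℕ) * C (X ^ (l' : ℕ))) * C (X ^ (l : ℕ)) :
            ℝ[X][X]) = h (i', l') • (X ^ (i + i' : ℕ) * C (X ^ (l + l' : ℕ))) := by
          rw [mul_smul_comm, smul_mul_assoc, pow_add, pow_add, C_mul]
          congr 1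
          ring
        rw [this, map_smul, cosGaussianFunctional_X_pow_mul_C, smul_eq_mul, mul_assoc]
      -- The Gaussian Hankel factor is cancelled here, the cosine one below.
      have h2 : ∀ i : Fin K, (fun l' : Fin L => ∑ i' : Fin K, h (i', l') *
          cosFunctional (X ^ (i + i' : ℕ))) = 0 := fun i =>
        gaussianFunctional.eq_zero_of_sum_mul_map_X_pow_eq_zero
          (fun _ => eq_zero_of_gaussianFunctional_sq_eq_zero) _ (h1 i)
      funext ⟨i, l⟩
      exact congrFun (cosFunctional.eq_zero_of_sum_mul_map_X_pow_eq_zero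
        (fun _ => eq_zero_of_cosFunctional_sq_eq_zero) (fun i' => h (i', l))
        (fun i => congrFun (h2 i) l)) i)
  refine ⟨(X + ∑ j, t j • (X ^ (j.1 : ℕ) * C (X ^ (j.2 : ℕ))) : ℝ[X][X]).eval p,
    fun k hk l hl => ?_⟩
  have h := ht (⟨k, hk⟩, ⟨l, hl⟩)
  rw [cosGaussianFunctional_X_pow_mul_C] at h
  simpa only [eval_mul, eval_pow, eval_C] using h

/-- The integrand is the derivative of -He_l(x) exp(-x²/2). -/
theorem gaussianFunctional_hermite_succ (l : ℕ) :
    gaussianFunctional ((hermite (l + 1)).map (Int.castRingHom ℝ)) = 0 := by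
  set q : ℝ[X] := (hermite l).map (Int.castRingHom ℝ) with hq
  have h1 : (hermite (l + 1)).map (Int.castRingHom ℝ) = X * q - derivative q := by
    rw [hermite_succ, Polynomial.map_sub, Polynomial.map_mul, map_X, derivative_map]
  rw [h1, gaussianFunctional_apply]
  refine integral_eq_zero_of_hasDerivAt_of_integrable
    (f := fun x => -(q.eval x * Real.exp (-(x ^ 2 / 2)))) (fun x => ?_)
    (X * q - derivative q).integrable_eval_mul_exp_neg_sq q.integrable_eval_mul_exp_neg_sq.neg
  have h2 : HasDerivAt (fun x : ℝ => -(x ^ 2 / 2)) (-x) x := by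
    refine (((hasDerivAt_pow 2 x).div_const 2).neg).congr_deriv ?_
    simp
  refine (((q.hasDerivAt x).mul h2.exp).neg).congr_deriv ?_
  simp only [eval_sub, eval_mul, eval_X]
  ring

theorem proposition1 (K L : ℕ) :
    ∃ f : Polynomial ℝ, 0 < f.natDegree ∧
      ∀ k l : ℕ, 1 ≤ k → k ≤ K → 1 ≤ l → l ≤ L →
        (∫ x : ℝ, (f.eval x) ^ k * Polynomial.aeval x (Polynomial.hermite l) *
          Real.exp (-(x ^ 2 / 2))) = 0 := by
  -- `K + 2` makes the first and second powers available even for K = 0; `L + 1` covers the degrees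
  -- 0 to L.
  obtain ⟨f, hf⟩ := exists_gaussianFunctional_pow_mul_X_pow_eq (K + 2) (L + 1)
  refine ⟨f, ?_, ?_⟩
  -- A constant f would vanish, since cos u has mean zero, but the second moment of cos u is
  -- nonzero.
  · have hpi := Real.pi_pos
    have hZ : gaussianFunctional 1 ≠ 0 := fun h => one_ne_zero (α := ℝ[X])
      (eq_zero_of_gaussianFunctional_sq_eq_zero (by rwa [one_pow]))
    have hc1 : cosFunctional X = 0 := by simp [cosFunctional_apply]
    have h1 := hf 0 (by omega) 0 (by omega)
    have h2 := hf 1 (by omega) 0 (by omega)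
    simp only [zero_add, pow_one, hc1, pow_zero, mul_one, zero_mul] at h1
    by_contra hdeg
    obtain ⟨c, rfl⟩ := natDegree_eq_zero.1 (Nat.eq_zero_of_not_pos hdeg)
    rw [← mul_one (C c), ← smul_eq_C_mul, map_smul, smul_eq_mul] at h1
    have hc : c = 0 := (mul_eq_zero.1 h1).resolve_right hZ
    rw [hc, map_zero, zero_pow two_ne_zero, zero_mul, map_zero, pow_zero] at h2
    exact X_ne_zero (eq_zero_of_cosFunctional_sq_eq_zero
      ((mul_eq_zero.1 h2.symm).resolve_right hZ))
  · rintro k l hk hkK hl hlL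
    obtain ⟨k, rfl⟩ := Nat.exists_eq_add_of_le' hk
    obtain ⟨l, rfl⟩ := Nat.exists_eq_add_of_le' hl
    set q : ℝ[X] := (hermite (l + 1)).map (Int.castRingHom ℝ) with hq
    have hdeg : q.natDegree < L + 1 :=
      (natDegree_map_le.trans natDegree_hermite.le).trans_lt (by omega)
    have h1 : gaussianFunctional (f ^ (k + 1) * q) =
        cosFunctional (X ^ (k + 1)) * gaussianFunctional q := by
      rw [q.as_sum_range' _ hdeg, Finset.mul_sum, map_sum, map_sum, Finset.mul_sum]
      refine Finset.sum_congr rfl fun n hn => ?_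
      rw [← C_mul_X_pow_eq_monomial, ← smul_eq_C_mul, mul_smul_comm, map_smul, map_smul,
        hf k (by omega) n (Finset.mem_range.1 hn), smul_eq_mul, smul_eq_mul]
      ring
    rw [hq, gaussianFunctional_hermite_succ, mul_zero, ← hq, gaussianFunctional_apply] at h1
    rw [← h1]
    refine integral_congr_ae (ae_of_all _ fun x => ?_)
    simp only [eval_mul, eval_pow, hq, eval_map, aeval_def, algebraMap_int_eq]
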